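/- Let $\tau$ lie in the complex upper half plane, $L=\mathbb Z+\mathbb Z\tau$, $E=\mathbb C/L$ with identity $P_0$, let $P_\alpha\in E$ be the image of $\alpha\in\mathbb C$, and let $\ell\ge 1$ be an integer. For $\alpha\in\frac1\ell L$ let $E_1(\tau,\alpha;s)$ be the analytic continuation to all $s\in\mathbb C$ (which exists, by Hecke) of $$\sum_{\omega\in L,\ \omega\neq-\alpha}\frac{1}{(\alpha+\omega)\,|\alpha+\omega|^{2s}}\qquad(\operatorname{Re}s>1/2),$$ where the series converges absolutely. It depends only on $P_\alpha$. Put $E_1(\tau,P_\alpha)=E_1(\tau,\alpha;0)$, and $E_1(\tau,D)=\sum_P m_P\,E_1(\tau,P)$ for a divisor $D=\sum_P m_P(P)$ supported on the $\ell$-torsion $E[\ell]$. Let $$\zeta(z)=\frac1z+\sum_{0\ne\omega\in L}\left[\frac1{z-\omega}+\frac1\omega+\frac z{\omega^2}\right]$$ be the Weierstrass zeta function of $L$, and let $\eta_1=\zeta(1/2)$, $\eta_2=\zeta(\tau/2)$; these are the constants for which $\zeta(z+m\tau+n)=\zeta(z)+2m\eta_2+2n\eta_1$ for all $m,n\in\mathbb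 Z$ and $z\notin L$. (i) Let $D$ be a principal divisor on $E$ (the divisor of a nonzero elliptic function) supported on $E[\ell]$. Let $\tilde D=\sum_\alpha m_\alpha(\alpha)$ be a principal lift of $D$, i.e. a divisor on $\mathbb C$ with image $D$ on $E$, with $\sum_\alpha m_\alpha=0$ and $\sum_\alpha m_\alpha\alpha=0$ in $\mathbb C$, and suppose that every instance of $P_0$ is lifted to $0$, i.e. that $0$ is the only element of $L$ that may occur in $\tilde D$. Then $$E_1(\tau,D)=\sum_{\alpha\neq0}m_\alpha\,\zeta(\alpha).$$ (ii) Let $a,b\in\mathbb Z$ and $\alpha=(a\tau+b)/\ell$ with $P_\alpha\neq P_0$. Then $$E_1(\tau,P_\alpha)=\zeta(\alpha)+\frac1\ell\bigl[\zeta(\alpha)-\zeta(\alpha+a\tau+b)\bigr]=\zeta\!\left(\frac{a\tau+b}{\ell}\right)-\frac a\ell\cdot2\eta_2-\frac b\ell\cdot2\eta_1 .$$ -/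

import Mathlib

open scoped UpperHalfPlane

noncomputable section

namespace EisensteinDivisor

/-- The pair of periods `(1, τ)` attached to a point `τ` of the upper half plane. -/
def periods (τ : ℍ) : PeriodPair where
  ω₁ := 1
  ω₂ := (τ : ℂ)
  indep := by
    refine LinearIndependent.pair_iff.mpr fun s t h => ?_
    have him := congrArg Complex.im h
    have hre := congrArg Complex.re h
    have ht : t = 0 := by
      have h0 : t * (τ : ℂ).im = 0 := by simpa using him
      exact (mul_eq_zero.mp h0).resolve_right τ.im_pos.ne'
    subst ht
    exact ⟨by simpa using hre, rfl⟩

/-- The lattice `L_τ = ℤ + ℤ τ`. -/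
abbrev lattice (τ : ℍ) : Submodule ℤ ℂ := (periods τ).lattice

/-- The elliptic curve `E_τ = ℂ / L_τ`, as a group. -/
abbrev Curve (τ : ℍ) : Type := ℂ ⧸ lattice τ

/-- The point `P_α` of `E_τ` that is the image of `α ∈ ℂ`. -/
abbrev point (τ : ℍ) (α : ℂ) : Curve τ := Submodule.Quotient.mk α

/-- The `ω`-term `1 / ((α + ω) ^ j * |α + ω| ^ (2 s))` of the Eisenstein series; the term with
`ω = -α` is omitted. -/
def eisensteinTerm (j : ℕ) (α s ω : ℂ) : ℂ :=
  if α + ω = 0 then 0 else 1 / ((α + ω) ^ j * ((‖α + ω‖ : ℝ) : ℂ) ^ (2 * s))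

/-- `F` is the analytic continuation to all of `ℂ` of
`s ↦ ∑' ω ∈ L_τ, 1 / ((α + ω) ^ j * |α + ω| ^ (2 s))`, a series that converges absolutely for
`Re s > 1 - j / 2`. By the identity theorem there is at most one such `F`. -/
def IsEisensteinContinuation (j : ℕ) (τ : ℍ) (α : ℂ) (F : ℂ → ℂ) : Prop :=
  Differentiable ℂ F ∧
    ∀ s : ℂ, 1 - (j : ℝ) / 2 < s.re →
      HasSum (fun ω : lattice τ => eisensteinTerm j α s (ω : ℂ)) (F s)

open Classical in
/-- `E_j(τ, α; s)` for `α ∈ ℂ` and all `s ∈ ℂ`: the analytic continuation of the Eisenstein series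
(and `0` should there be none). -/
def eisenstein (j : ℕ) (τ : ℍ) (α : ℂ) : ℂ → ℂ :=
  if h : ∃ F, IsEisensteinContinuation j τ α F then h.choose else 0

theorem isEisensteinContinuation_add (j : ℕ) (τ : ℍ) (α : ℂ) (l : lattice τ) :
    IsEisensteinContinuation j τ (α + l) = IsEisensteinContinuation j τ α := by
  funext F
  refine propext (and_congr Iff.rfl (forall_congr' fun s => imp_congr Iff.rfl ?_))
  rw [← (Equiv.addLeft l).hasSum_iff (f := fun ω : lattice τ => eisensteinTerm j α s (ω : ℂ))]
  have : (fun ω : lattice τ => eisensteinTerm j (α + l) s (ω : ℂ)) =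
      (fun ω : lattice τ => eisensteinTerm j α s (ω : ℂ)) ∘ Equiv.addLeft l := by
    funext ω
    simp [eisensteinTerm, add_assoc]
  rw [this]

theorem eisenstein_add (j : ℕ) (τ : ℍ) (α : ℂ) (l : lattice τ) :
    eisenstein j τ (α + l) = eisenstein j τ α := by
  unfold eisenstein
  rw [isEisensteinContinuation_add]

/-- `E_j(τ, P; s)` for a point `P` of `E_τ`; it is `E_j(τ, α; s)` for any `α` with `P = P_α`. -/
def eisensteinPoint (j : ℕ) (τ : ℍ) (P : Curve τ) : ℂ → ℂ :=
  Quotient.liftOn' P (eisenstein j τ) (by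
    intro α β h
    have h' : α - β ∈ lattice τ := (Submodule.quotientRel_def _).mp h
    have := eisenstein_add j τ β ⟨α - β, h'⟩
    simpa using this)

@[simp] theorem eisensteinPoint_point (j : ℕ) (τ : ℍ) (α : ℂ) :
    eisensteinPoint j τ (point τ α) = eisenstein j τ α := rfl

/-- `E_j(τ, D; s) = ∑ m_P E_j(τ, P; s)` for a divisor `D = ∑ m_P (P)` on `E_τ`. -/
def eisensteinDiv (j : ℕ) (τ : ℍ) (D : Curve τ →₀ ℤ) (s : ℂ) : ℂ :=
  D.sum fun P m => (m : ℂ) * eisensteinPoint j τ P s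

/-- The divisor on `E_τ` that is the image of a divisor on `ℂ`. -/
def image (τ : ℍ) (Dt : ℂ →₀ ℤ) : Curve τ →₀ ℤ := Dt.mapDomain (point τ)

/-- `E_j(τ, D; s)` can be computed from any lift of `D` to `ℂ`. -/
theorem eisensteinDiv_image (j : ℕ) (τ : ℍ) (Dt : ℂ →₀ ℤ) (s : ℂ) :
    eisensteinDiv j τ (image τ Dt) s = Dt.sum fun α m => (m : ℂ) * eisenstein j τ α s := by
  unfold eisensteinDiv image
  rw [Finsupp.sum_mapDomain_index (by simp) (by intros; push_cast; ring)]
  rfl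

/-- `D` is a principal divisor on `E_τ`: it is the divisor of a nonzero elliptic function `f`, that
is, of a meromorphic function on `ℂ` with period lattice containing `L_τ`. (As the order of `f` is
required to be finite at every point, `f` does not vanish identically.) -/
def IsPrincipal (τ : ℍ) (D : Curve τ →₀ ℤ) : Prop :=
  ∃ f : ℂ → ℂ, (∀ z, MeromorphicAt f z) ∧ (∀ ω ∈ lattice τ, ∀ z, f (z + ω) = f z) ∧
    ∀ z, meromorphicOrderAt f z = ((D (point τ z) : ℤ) : WithTop ℤ)

/-- `Dt = ∑ m_α (α)` is a principal lift of `D`: its image is `D`, and `∑ m_α = 0` and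
`∑ m_α α = 0` in `ℂ`. -/
structure IsPrincipalLift (τ : ℍ) (Dt : ℂ →₀ ℤ) (D : Curve τ →₀ ℤ) : Prop where
  image_eq : image τ Dt = D
  sum_mult : (Dt.sum fun _ m => m) = 0
  sum_point : (Dt.sum fun α m => (m : ℂ) * α) = 0

/-- The Weierstrass zeta function of `L_τ`. -/
def zeta (τ : ℍ) (z : ℂ) : ℂ :=
  1 / z + ∑' ω : {ω : lattice τ // ω ≠ 0},
    (1 / (z - (ω.1 : ℂ)) + 1 / (ω.1 : ℂ) + z / (ω.1 : ℂ) ^ 2)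

/-- `η₁ = ζ(1/2)`; the quasi-period of `ζ` for the period `1` is `2 η₁`. -/
def eta₁ (τ : ℍ) : ℂ := zeta τ (1 / 2)

/-- `η₂ = ζ(τ/2)`; the quasi-period of `ζ` for the period `τ` is `2 η₂`. -/
def eta₂ (τ : ℍ) : ℂ := zeta τ ((τ : ℂ) / 2)

end EisensteinDivisor

end

noncomputable section

namespace EisensteinDivisor

/-! For Re s > 1/2 the series is π^(s+1)/Γ(s+1) times the Mellin transform at s + 1 of θ(t) = ∑
conj(α+ω) exp(-π|α+ω|²t). Since θ decays faster than every power of t at both 0 and ∞, this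
continues to an entire function, and at s = 0 it gives E₁(α;0) = lim ∑ exp(-πε|α+ω|²)/(α+ω) as ε →
0+.

For α outside L, split 1/(α+ω) into the ζ-term 1/(α+ω) - 1/ω + α/ω² and the rest 1/ω - α/ω², and
expand the Gaussian weight of the rest in α. The ζ-terms tend to ζ(α) by dominated convergence, the
second-order part tends to 0, ∑ exp(-πε|ω|²)/ω vanishes by oddness, and what remains is real-linear
in α for every ε. So E₁(α;0) - ζ(α) is real-linear in α off the lattice
(`eisenstein_one_sub_zeta_linear`), without the limit of the linear part ever being computed.

As E₁ is odd and L-periodic, it vanishes at 1/2 and τ/2. This fixes the linear function: E₁(xτ+y;0)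
= ζ(xτ+y) - 2xη₂ - 2yη₁ (`eisenstein_one_apply_zero`), which contains (ii). Periodicity of E₁ then
yields the quasi-periods of ζ, and in (i) the linear corrections cancel because ∑ m_α α = 0. -/

/-! ### Decay of the one-variable theta kernels -/

open Real in
theorem exp_neg_pi_sq_mul_le {n : ℤ} (hn : n ≠ 0) {y : ℝ} (hy : 1 ≤ y) :
    rexp (-π * n ^ 2 * y) ≤ rexp (-π * n ^ 2 / 2) * rexp (-(π / 2) * y) := by
  rw [← Real.exp_add, Real.exp_le_exp]
  have h1 : (1 : ℝ) ≤ (n : ℝ) ^ 2 := by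
    have : (1 : ℤ) ≤ n ^ 2 := by
      have := sq_pos_of_ne_zero hn
      omega
    exact_mod_cast this
  -- This expression is 2n²y - n² - y, twice the gap between the exponents divided by π.
  have h2 : 0 ≤ ((n : ℝ) ^ 2 - 1) * (2 * y - 1) + (y - 1) :=
    add_nonneg (mul_nonneg (by linarith) (by linarith)) (by linarith)
  have := mul_nonneg pi_pos.le h2
  nlinarith

open Real in
theorem summable_abs_pow_mul_exp_neg_pi_sq (k : ℕ) :
    Summable fun n : ℤ => (|n| : ℝ) ^ k * rexp (-π * n ^ 2 / 2) := by
  refine (summable_pow_mul_jacobiTheta₂_term_bound 0 (T := 1 / 2) (by norm_num) k).congr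
    fun n => ?_
  push_cast
  congr 2
  ring

open HurwitzZeta Real in
theorem exists_abs_cosKernel_sub_one_le :
    ∃ C, ∀ a y : ℝ, 1 ≤ y → |cosKernel a y - 1| ≤ C * rexp (-(π / 2) * y) := by
  have hs := summable_abs_pow_mul_exp_neg_pi_sq 0
  simp only [pow_zero, one_mul] at hs
  refine ⟨∑' n : ℤ, rexp (-π * n ^ 2 / 2), fun a y hy => ?_⟩
  have h := hasSum_int_cosKernel₀ a (zero_lt_one.trans_le hy)
  have hb := hs.hasSum.mul_right (rexp (-(π / 2) * y))
  have : ‖((cosKernel a y : ℝ) : ℂ) - 1‖ ≤ _ := h.norm_le_of_bounded hb fun n => by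
    split_ifs with hn
    · rw [norm_zero]; positivity
    · rw [norm_mul, Complex.norm_real, Real.norm_of_nonneg (Real.exp_pos _).le]
      have : ‖Complex.exp (2 * π * Complex.I * a * n)‖ = 1 := by
        rw [show (2 * π * Complex.I * a * n : ℂ) = ((2 * π * a * n : ℝ) : ℂ) * Complex.I by
          push_cast; ring]
        exact Complex.norm_exp_ofReal_mul_I _
      rw [this, one_mul]
      exact exp_neg_pi_sq_mul_le hn hy
  rwa [← Complex.ofReal_one, ← Complex.ofReal_sub, Complex.norm_real, Real.norm_eq_abs] at this

open HurwitzZeta Real in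
theorem exists_abs_sinKernel_le :
    ∃ C, ∀ a y : ℝ, 1 ≤ y → |sinKernel a y| ≤ C * rexp (-(π / 2) * y) := by
  have hs := summable_abs_pow_mul_exp_neg_pi_sq 1
  simp only [pow_one] at hs
  refine ⟨∑' n : ℤ, (|n| : ℝ) * rexp (-π * n ^ 2 / 2), fun a y hy => ?_⟩
  have h := hasSum_int_sinKernel a (zero_lt_one.trans_le hy)
  have hb := hs.hasSum.mul_right (rexp (-(π / 2) * y))
  have : ‖((sinKernel a y : ℝ) : ℂ)‖ ≤ _ := h.norm_le_of_bounded hb fun n => by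
    rcases eq_or_ne n 0 with rfl | hn
    · simp
    · have : ‖Complex.exp (2 * π * Complex.I * a * n)‖ = 1 := by
        rw [show (2 * π * Complex.I * a * n : ℂ) = ((2 * π * a * n : ℝ) : ℂ) * Complex.I by
          push_cast; ring]
        exact Complex.norm_exp_ofReal_mul_I _
      rw [norm_mul, norm_mul, Complex.norm_real, Real.norm_of_nonneg (Real.exp_pos _).le, this,
        norm_mul, norm_neg, Complex.norm_I, Complex.norm_intCast, one_mul, mul_one, mul_assoc]
      simpa only [mul_assoc] using
        mul_le_mul_of_nonneg_left (exp_neg_pi_sq_mul_le hn hy) (abs_nonneg (n : ℝ))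
  rwa [Complex.norm_real, Real.norm_eq_abs] at this

open Real in
theorem summable_exp_neg_mul_abs_int {c : ℝ} (hc : 0 < c) :
    Summable fun n : ℤ => rexp (-c * |(n : ℝ)|) := by
  have h : Summable fun n : ℕ => rexp (-c * n) := by
    have := summable_geometric_of_lt_one (Real.exp_pos (-c)).le (by simpa using hc)
    refine this.congr fun n => ?_
    rw [← Real.exp_nat_mul, mul_comm]
  refine Summable.of_nat_of_neg ?_ ?_ <;> simpa using h

open Real in
theorem summable_one_add_abs_mul_exp {v : ℝ} (hv : 0 < v) (x : ℝ) :
    Summable fun m : ℤ => (1 + v * |m + x|) * rexp (-π * (v * |m + x|)) := by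
  refine Summable.of_nonneg_of_le (fun m => by positivity) (fun m => ?_)
    ((summable_exp_neg_mul_abs_int hv).mul_left (rexp (v * |x|)))
  have h1 : 1 + v * |m + x| ≤ rexp (v * |m + x|) := by
    linarith [Real.add_one_le_exp (v * |m + x|)]
  have h2 : |(m : ℝ)| ≤ |m + x| + |x| := by
    have := abs_sub (m + x : ℝ) x
    simpa using this
  calc _ ≤ rexp (v * |m + x|) * rexp (-π * (v * |m + x|)) := by gcongr
    _ = rexp ((1 - π) * (v * |m + x|)) := by rw [← Real.exp_add]; ring_nf
    _ ≤ rexp (-1 * (v * |m + x|)) := by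
      gcongr
      linarith [pi_gt_three]
    _ ≤ rexp (v * |x| + -v * |(m : ℝ)|) := by
      gcongr
      nlinarith
    _ = _ := Real.exp_add _ _

-- The functional equation t ↦ 1/t turns the exponential decay of `sinKernel` at infinity into decay
-- at 0. For the even kernel below, the constant term 1 of `cosKernel` becomes the leading term
-- t^(-1/2).
open HurwitzZeta Real in
theorem exists_abs_oddKernel_le : ∃ C, 0 ≤ C ∧ ∀ a t : ℝ, 0 < t → t ≤ 1 →
    |oddKernel a t| ≤ C * (t ^ (-(3 / 2) : ℝ) * rexp (-(π / 2) * t⁻¹)) := by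
  obtain ⟨C, hC⟩ := exists_abs_sinKernel_le
  refine ⟨|C|, abs_nonneg _, fun a t ht ht1 => ?_⟩
  have h := hC a t⁻¹ ((one_le_inv₀ ht).mpr ht1)
  rw [oddKernel_functional_equation, one_div, one_div, abs_mul, ← Real.rpow_neg ht.le,
    abs_of_nonneg (Real.rpow_nonneg ht.le _), mul_left_comm]
  gcongr
  exact h.trans (by gcongr; exact le_abs_self C)

open HurwitzZeta Real in
theorem exists_abs_evenKernel_sub_le : ∃ C, 0 ≤ C ∧ ∀ a t : ℝ, 0 < t → t ≤ 1 →
    |evenKernel a t - t ^ (-(1 / 2) : ℝ)| ≤ C * (t ^ (-(3 / 2) : ℝ) * rexp (-(π / 2) * t⁻¹)) := by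
  obtain ⟨C, hC⟩ := exists_abs_cosKernel_sub_one_le
  refine ⟨|C|, abs_nonneg _, fun a t ht ht1 => ?_⟩
  have h := hC a t⁻¹ ((one_le_inv₀ ht).mpr ht1)
  rw [evenKernel_functional_equation, one_div, one_div, ← Real.rpow_neg ht.le,
    ← mul_sub_one, abs_mul, abs_of_nonneg (Real.rpow_nonneg ht.le _), mul_left_comm]
  have h3 : t ^ (-2⁻¹ : ℝ) ≤ t ^ (-(3 / 2) : ℝ) :=
    Real.rpow_le_rpow_of_exponent_ge ht ht1 (by norm_num)
  rw [← one_div] at h3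
  simp only [one_div] at h3 ⊢
  gcongr
  exact h.trans (by gcongr; exact le_abs_self C)

open Filter Asymptotics Topology in
theorem isBigO_rpow_mul_exp_neg_inv {c : ℝ} (hc : 0 < c) (r N : ℝ) :
    (fun t : ℝ => t ^ r * Real.exp (-c * t⁻¹)) =O[𝓝[>] 0] fun t => t ^ N := by
  have h := ((isLittleO_exp_neg_mul_rpow_atTop hc (r - N)).comp_tendsto
    tendsto_inv_nhdsGT_zero).isBigO
  refine ((isBigO_refl (fun t : ℝ => t ^ r) _).mul h).congr' .rfl ?_
  filter_upwards [self_mem_nhdsWithin] with t ht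
  have ht : 0 < t := ht
  simp only [Function.comp_apply]
  rw [Real.inv_rpow ht.le, ← Real.rpow_neg ht.le, ← Real.rpow_add ht]
  ring_nf

open Filter Asymptotics Topology HurwitzZeta in
theorem isBigO_oddKernel (a N : ℝ) : oddKernel a =O[𝓝[>] 0] fun t => t ^ N := by
  obtain ⟨C, -, hC⟩ := exists_abs_oddKernel_le
  refine IsBigO.trans (IsBigO.of_bound C ?_)
    (isBigO_rpow_mul_exp_neg_inv (half_pos Real.pi_pos) (-(3 / 2)) N)
  filter_upwards [Ioc_mem_nhdsGT (zero_lt_one (α := ℝ))] with t ht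
  have := Real.rpow_nonneg ht.1.le (-(3 / 2))
  rw [Real.norm_eq_abs, Real.norm_of_nonneg (by positivity)]
  exact hC a t ht.1 ht.2

open Filter Asymptotics Topology HurwitzZeta in
theorem isBigO_rpow_mul_oddKernel_mul {c : ℝ} (hc : 0 < c) (a r N : ℝ) :
    (fun t => t ^ r * oddKernel a (c * t)) =O[𝓝[>] 0] fun t => t ^ N := by
  have ht : Tendsto (fun t : ℝ => c * t) (𝓝[>] 0) (𝓝[>] 0) := by
    refine tendsto_nhdsWithin_iff.mpr ⟨?_, ?_⟩
    · exact ((continuous_const_mul c).tendsto' 0 0 (mul_zero c)).mono_left nhdsWithin_le_nhds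
    · filter_upwards [self_mem_nhdsWithin] with t ht using mul_pos hc ht
  have h := (isBigO_oddKernel a (N - r)).comp_tendsto ht
  refine ((isBigO_refl (fun t : ℝ => t ^ r) _).mul h).trans ?_
  refine IsBigO.of_bound (c ^ (N - r)) ?_
  filter_upwards [self_mem_nhdsWithin] with t ht
  have ht : 0 < t := ht
  simp only [Function.comp_apply]
  rw [Real.mul_rpow hc.le ht.le, mul_left_comm, ← Real.rpow_add ht, norm_mul,
    Real.norm_of_nonneg (Real.rpow_nonneg hc.le _)]
  ring_nf
  rfl

/-! ### The lattice theta series and its decay at infinity -/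

section Lattice

variable (τ : ℍ) (α : ℂ)

theorem summable_norm_add_rpow {r : ℝ} (hr : r < -2) :
    Summable fun ω : lattice τ => ‖α + ω‖ ^ r := by
  have := ZLattice.summable_norm_sub_rpow (lattice τ) r (by simpa using hr) (-α)
  simpa [add_comm] using this

theorem summable_norm_add_zpow {n : ℤ} (hn : n < -2) :
    Summable fun ω : lattice τ => ‖α + ω‖ ^ n := by
  have := ZLattice.summable_norm_sub_zpow (lattice τ) n (by simpa using hn) (-α)
  simpa [add_comm] using this

theorem mul_exp_neg_pi_sq_mul_le {r t : ℝ} (hr : 0 ≤ r) (ht : 0 < t) (N : ℕ) :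
    r * Real.exp (-Real.pi * r ^ 2 * t) ≤
      (N.factorial : ℝ) * r ^ (1 - 2 * N : ℤ) * (t ^ N)⁻¹ := by
  rcases hr.eq_or_lt with rfl | hr
  · rw [zero_mul]; positivity
  have h := Real.pow_div_factorial_le_exp (r ^ 2 * t) (by positivity) N
  have hf : (0 : ℝ) < N.factorial := by positivity
  have h1 : Real.exp (-Real.pi * r ^ 2 * t) ≤ N.factorial / (r ^ 2 * t) ^ N := by
    calc _ ≤ Real.exp (-(r ^ 2 * t)) := by
          rw [Real.exp_le_exp]
          have := mul_nonneg (sub_nonneg.mpr (one_lt_two.le.trans Real.two_le_pi))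
            (mul_pos (pow_pos hr 2) ht).le
          linarith
      _ ≤ _ := by
          rw [Real.exp_neg, ← inv_div]
          gcongr
  calc _ ≤ r * (N.factorial / (r ^ 2 * t) ^ N) := by gcongr
    _ = _ := by
      rw [zpow_sub₀ hr.ne', zpow_one, mul_pow, ← pow_mul,
        show (2 * N : ℤ) = ((2 * N : ℕ) : ℤ) by push_cast; rfl, zpow_natCast]
      field_simp

theorem summable_norm_mul_exp {t : ℝ} (ht : 0 < t) :
    Summable fun ω : lattice τ => ‖α + ω‖ * Real.exp (-Real.pi * ‖α + ω‖ ^ 2 * t) :=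
  Summable.of_nonneg_of_le (fun _ => by positivity)
    (fun _ => mul_exp_neg_pi_sq_mul_le (norm_nonneg _) ht 2)
    (((summable_norm_add_zpow τ α (by norm_num)).mul_left _).mul_right _)

/-- The theta series `∑ conj (α + ω) exp (-π |α + ω|² t)` over the lattice. -/
def theta (t : ℝ) : ℂ :=
  ∑' ω : lattice τ, (starRingEnd ℂ) (α + ω) * (Real.exp (-Real.pi * ‖α + ω‖ ^ 2 * t) : ℝ)

variable {τ α} in
theorem norm_thetaTerm (ω : lattice τ) (t : ℝ) :
    ‖(starRingEnd ℂ) (α + ω) * (Real.exp (-Real.pi * ‖α + ω‖ ^ 2 * t) : ℝ)‖ =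
      ‖α + ω‖ * Real.exp (-Real.pi * ‖α + ω‖ ^ 2 * t) := by
  rw [norm_mul, RCLike.norm_conj, Complex.norm_real, Real.norm_of_nonneg (Real.exp_pos _).le]

theorem hasSum_theta {t : ℝ} (ht : 0 < t) :
    HasSum (fun ω : lattice τ =>
      (starRingEnd ℂ) (α + ω) * (Real.exp (-Real.pi * ‖α + ω‖ ^ 2 * t) : ℝ)) (theta τ α t) :=
  (Summable.of_norm ((summable_norm_mul_exp τ α ht).congr
    fun ω => (norm_thetaTerm ω t).symm)).hasSum

theorem continuousOn_theta : ContinuousOn (theta τ α) (Set.Ioi 0) := by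
  intro t ht
  have ht : 0 < t := ht
  have : ContinuousOn (theta τ α) (Set.Ioi (t / 2)) := by
    refine continuousOn_tsum (fun ω => by fun_prop)
      (summable_norm_mul_exp τ α (half_pos ht)) fun ω s hs => ?_
    rw [norm_thetaTerm]
    refine mul_le_mul_of_nonneg_left (Real.exp_le_exp.mpr ?_) (norm_nonneg _)
    have : (0 : ℝ) ≤ Real.pi * ‖α + ω‖ ^ 2 := by positivity
    have hs : t / 2 < s := hs
    nlinarith
  exact (this.continuousAt (Ioi_mem_nhds (by linarith))).continuousWithinAt

-- There is no constant term to subtract even if -α lies in L: the factor conj(α+ω) kills the term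
-- with α + ω = 0. Taking N ≥ 2 makes the exponent 1 - 2N summable over the lattice.
open Filter Asymptotics in
theorem isBigO_theta_atTop (a : ℝ) : theta τ α =O[atTop] fun t => t ^ (-a) := by
  obtain ⟨N, hN⟩ := exists_nat_ge (max a 2)
  have hN2 : 2 ≤ N := by exact_mod_cast (le_max_right a 2).trans hN
  refine IsBigO.trans (g := fun t : ℝ => (t ^ N)⁻¹) (IsBigO.of_bound
    (∑' ω : lattice τ, (N.factorial : ℝ) * ‖α + ω‖ ^ (1 - 2 * N : ℤ)) ?_) ?_
  · filter_upwards [eventually_gt_atTop 0] with t ht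
    rw [Real.norm_of_nonneg (by positivity)]
    refine (hasSum_theta τ α ht).norm_le_of_bounded
      (((summable_norm_add_zpow τ α (by omega)).mul_left _).hasSum.mul_right _) fun ω => ?_
    rw [norm_thetaTerm]
    exact mul_exp_neg_pi_sq_mul_le (norm_nonneg _) ht N
  · refine IsBigO.of_bound 1 ?_
    filter_upwards [eventually_ge_atTop 1] with t ht
    have ht0 : 0 < t := by linarith
    rw [one_mul, Real.norm_of_nonneg (by positivity), Real.norm_of_nonneg (by positivity),
      ← Real.rpow_natCast, ← Real.rpow_neg ht0.le]
    exact Real.rpow_le_rpow_of_exponent_le ht (neg_le_neg ((le_max_left a 2).trans hN))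

/-! ### Decay of the theta series at zero, by rows -/

theorem hasSum_int_prod_theta {t : ℝ} (ht : 0 < t) :
    HasSum (fun p : ℤ × ℤ => (starRingEnd ℂ) (α + (p.2 + p.1 * τ)) *
      (Real.exp (-Real.pi * ‖α + (p.2 + p.1 * τ)‖ ^ 2 * t) : ℝ)) (theta τ α t) := by
  have h := (Equiv.hasSum_iff
    ((Equiv.prodComm ℤ ℤ).trans (periods τ).latticeEquivProd.symm.toEquiv)).mpr
    (hasSum_theta τ α ht)
  refine h.congr_fun fun p => ?_
  have : (((periods τ).latticeEquivProd.symm p.swap : lattice τ) : ℂ) = p.2 + p.1 * τ := by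
    rw [PeriodPair.latticeEquiv_symm_apply]
    simp [periods]
  simp [this]

open HurwitzZeta Real in
/-- The sum of the theta series over the row `α + ℤ + m τ` of the lattice. -/
theorem hasSum_theta_row (m : ℤ) {t : ℝ} (ht : 0 < t) :
    HasSum (fun n : ℤ => (starRingEnd ℂ) (α + (n + m * τ)) *
      (rexp (-π * ‖α + (n + m * τ)‖ ^ 2 * t) : ℝ))
      (rexp (-π * (m + α.im / τ.im) ^ 2 * (τ.im ^ 2 * t)) *
        (oddKernel ((α.re + m * τ.re : ℝ)) t -
          Complex.I * (τ.im * (m + α.im / τ.im)) * evenKernel ((α.re + m * τ.re : ℝ)) t)) := by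
  have ho := Complex.hasSum_ofReal.mpr (hasSum_int_oddKernel (α.re + m * τ.re) ht)
  have he := Complex.hasSum_ofReal.mpr (hasSum_int_evenKernel (α.re + m * τ.re) ht)
  refine ((ho.sub (he.mul_left (Complex.I * (τ.im * (m + α.im / τ.im))))).mul_left
    (rexp (-π * (m + α.im / τ.im) ^ 2 * (τ.im ^ 2 * t)) : ℂ)).congr_fun fun n => ?_
  have hv := τ.im_ne_zero
  have him : (α + (n + m * τ)).im = τ.im * (m + α.im / τ.im) := by
    simp only [Complex.add_im, Complex.mul_im, Complex.intCast_im, Complex.intCast_re,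
      UpperHalfPlane.coe_im]
    field_simp
    ring
  have hre : (α + (n + m * τ)).re = n + (α.re + m * τ.re) := by
    simp
    ring
  have hw : (starRingEnd ℂ) (α + (n + m * τ)) =
      ((n + (α.re + m * τ.re) : ℝ) : ℂ) -
        Complex.I * ((τ.im * (m + α.im / τ.im) : ℝ) : ℂ) := by
    rw [← hre, ← him]
    apply Complex.ext
    · simp
    · simp
      ring
  have hn : ‖α + (n + m * τ)‖ ^ 2 =
      (n + (α.re + m * τ.re)) ^ 2 + (τ.im * (m + α.im / τ.im)) ^ 2 := by
    rw [← hre, ← him, Complex.sq_norm, Complex.normSq_apply]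
    ring
  have hexp : rexp (-π * ‖α + (n + m * τ)‖ ^ 2 * t) =
      rexp (-π * (m + α.im / τ.im) ^ 2 * (τ.im ^ 2 * t)) *
        rexp (-π * (n + (α.re + m * τ.re)) ^ 2 * t) := by
    rw [← Real.exp_add, hn]
    ring_nf
  rw [hw, hexp]
  push_cast
  ring

-- In each row the leading term t^(-1/2) of the even kernel is not small. Summed over the rows
-- against (m + Im α/Im τ) and its Gaussian, these terms form an odd kernel in the direction of τ,
-- which decays by itself; hence it is moved to the right-hand side.
open HurwitzZeta Real in
theorem hasSum_theta_sub {t : ℝ} (ht : 0 < t) :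
    HasSum (fun m : ℤ => (rexp (-π * (m + α.im / τ.im) ^ 2 * (τ.im ^ 2 * t)) : ℂ) *
        (oddKernel ((α.re + m * τ.re : ℝ)) t - Complex.I * (τ.im * (m + α.im / τ.im)) *
          ((evenKernel ((α.re + m * τ.re : ℝ)) t - t ^ (-(1 / 2) : ℝ) : ℝ) : ℂ)))
      (theta τ α t + Complex.I * τ.im *
        ((t ^ (-(1 / 2) : ℝ) * oddKernel ((α.im / τ.im : ℝ)) (τ.im ^ 2 * t) : ℝ) : ℂ)) := by
  have h1 := (hasSum_int_prod_theta τ α ht).prod_fiberwise fun m => hasSum_theta_row τ α m ht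
  have h2 := Complex.hasSum_ofReal.mpr
    (hasSum_int_oddKernel (α.im / τ.im) (mul_pos (pow_pos τ.im_pos 2) ht))
  have h3 := h1.add (h2.mul_left (Complex.I * τ.im * (t ^ (-(1 / 2) : ℝ) : ℝ)))
  rw [Complex.ofReal_mul, ← mul_assoc]
  refine h3.congr_fun fun m => ?_
  push_cast
  ring

open HurwitzZeta Real in
theorem exists_norm_theta_sub_le : ∃ C, ∀ t, 0 < t → t ≤ 1 →
    ‖theta τ α t + Complex.I * τ.im *
        ((t ^ (-(1 / 2) : ℝ) * oddKernel ((α.im / τ.im : ℝ)) (τ.im ^ 2 * t) : ℝ) : ℂ)‖ ≤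
      C * (t ^ (-(3 / 2) : ℝ) * rexp (-(π / 4) * t⁻¹)) := by
  obtain ⟨C₁, hC₁, ho⟩ := exists_abs_oddKernel_le
  obtain ⟨C₂, hC₂, he⟩ := exists_abs_evenKernel_sub_le
  have hs := summable_one_add_abs_mul_exp τ.im_pos (α.im / τ.im)
  refine ⟨(C₁ + C₂) * ∑' m : ℤ, (1 + τ.im * |m + α.im / τ.im|) *
    rexp (-π * (τ.im * |m + α.im / τ.im|)), fun t ht ht1 => ?_⟩
  refine (hasSum_theta_sub τ α ht).norm_le_of_bounded ((hs.hasSum.mul_left _).mul_right _)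
    fun m => ?_
  have hv := τ.im_pos
  set μ : ℝ := m + α.im / τ.im with hμ
  have hμ' : (m + α.im / τ.im : ℂ) = (μ : ℝ) := by rw [hμ]; push_cast; rfl
  set a : ℝ := α.re + m * τ.re
  have ht3 : 0 < t ^ (-(3 / 2) : ℝ) := rpow_pos_of_pos ht _
  rw [hμ', norm_mul, Complex.norm_real, Real.norm_of_nonneg (Real.exp_pos _).le]
  have hmain : ‖(oddKernel a t : ℂ) - Complex.I * (τ.im * μ) *
      ((evenKernel a t - t ^ (-(1 / 2) : ℝ) : ℝ) : ℂ)‖ ≤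
      (C₁ + C₂) * (1 + τ.im * |μ|) * (t ^ (-(3 / 2) : ℝ) * rexp (-(π / 2) * t⁻¹)) := by
    refine (norm_sub_le _ _).trans ?_
    rw [norm_mul, norm_mul, norm_mul, Complex.norm_I, one_mul, Complex.norm_real,
      Complex.norm_real, Complex.norm_real, Complex.norm_real, Real.norm_eq_abs, Real.norm_eq_abs,
      Real.norm_eq_abs, Real.norm_eq_abs, abs_of_pos hv]
    have h1 := ho a t ht ht1
    have h2 := mul_le_mul_of_nonneg_left (he a t ht ht1) (mul_nonneg hv.le (abs_nonneg μ))
    set q := t ^ (-(3 / 2) : ℝ) * rexp (-(π / 2) * t⁻¹)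
    have hq : 0 ≤ q := by positivity
    have h3 : 0 ≤ C₁ * (τ.im * |μ|) * q := by positivity
    have h4 : 0 ≤ C₂ * q := by positivity
    linarith
  -- Completing the square trades half of exp(-π/(2t)) for the factor exp(-π Im τ |μ|), which makes
  -- the sum over rows converge uniformly in t.
  have hexp : rexp (-π * μ ^ 2 * (τ.im ^ 2 * t)) * rexp (-(π / 2) * t⁻¹) ≤
      rexp (-π * (τ.im * |μ|)) * rexp (-(π / 4) * t⁻¹) := by
    rw [← Real.exp_add, ← Real.exp_add, Real.exp_le_exp]
    have h : 0 ≤ π * (t * (τ.im * |μ| - t⁻¹ / 2) ^ 2) := by positivity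
    have h' : t * (τ.im * |μ| - t⁻¹ / 2) ^ 2 =
        μ ^ 2 * (τ.im ^ 2 * t) - τ.im * |μ| + t⁻¹ / 4 := by
      rw [← sq_abs μ]
      field_simp
      ring
    rw [h'] at h
    linarith
  calc _ ≤ rexp (-π * μ ^ 2 * (τ.im ^ 2 * t)) * ((C₁ + C₂) * (1 + τ.im * |μ|) *
        (t ^ (-(3 / 2) : ℝ) * rexp (-(π / 2) * t⁻¹))) := by gcongr
    _ = (C₁ + C₂) * (1 + τ.im * |μ|) * t ^ (-(3 / 2) : ℝ) *
        (rexp (-π * μ ^ 2 * (τ.im ^ 2 * t)) * rexp (-(π / 2) * t⁻¹)) := by ring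
    _ ≤ (C₁ + C₂) * (1 + τ.im * |μ|) * t ^ (-(3 / 2) : ℝ) *
        (rexp (-π * (τ.im * |μ|)) * rexp (-(π / 4) * t⁻¹)) := by gcongr
    _ = _ := by ring

open HurwitzZeta Filter Asymptotics Topology in
theorem isBigO_theta_zero (N : ℝ) : theta τ α =O[𝓝[>] 0] fun t => t ^ N := by
  obtain ⟨C, hC⟩ := exists_norm_theta_sub_le τ α
  have h1 : (fun t : ℝ => theta τ α t + Complex.I * τ.im *
      ((t ^ (-(1 / 2) : ℝ) * oddKernel ((α.im / τ.im : ℝ)) (τ.im ^ 2 * t) : ℝ) : ℂ))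
      =O[𝓝[>] 0] fun t => t ^ N := by
    refine IsBigO.trans (IsBigO.of_bound C ?_) (isBigO_rpow_mul_exp_neg_inv
      (div_pos Real.pi_pos four_pos) (-(3 / 2)) N)
    filter_upwards [Ioc_mem_nhdsGT (zero_lt_one (α := ℝ))] with t ht
    have := Real.rpow_nonneg ht.1.le (-(3 / 2))
    rw [Real.norm_of_nonneg (by positivity)]
    exact hC t ht.1 ht.2
  have h2 := (Complex.isBigO_ofReal_left.mpr (isBigO_rpow_mul_oddKernel_mul
    (pow_pos τ.im_pos 2) (α.im / τ.im) (-(1 / 2)) N)).const_mul_left (Complex.I * τ.im)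
  simpa using h1.sub h2

/-! ### Mellin transform and analytic continuation -/

theorem locallyIntegrableOn_theta :
    MeasureTheory.LocallyIntegrableOn (theta τ α) (Set.Ioi 0) :=
  (continuousOn_theta τ α).locallyIntegrableOn measurableSet_Ioi

theorem mellinConvergent_theta (s : ℂ) : MellinConvergent (theta τ α) s :=
  mellinConvergent_of_isBigO_rpow (locallyIntegrableOn_theta τ α)
    (isBigO_theta_atTop τ α (s.re + 1)) (lt_add_one _)
    (isBigO_theta_zero τ α (-(s.re - 1))) (sub_one_lt _)

theorem differentiable_mellin_theta : Differentiable ℂ (mellin (theta τ α)) := fun s =>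
  mellin_differentiableAt_of_isBigO_rpow (locallyIntegrableOn_theta τ α)
    (isBigO_theta_atTop τ α (s.re + 1)) (lt_add_one _)
    (isBigO_theta_zero τ α (-(s.re - 1))) (sub_one_lt _)

/-- The Mellin transform of the theta series, normalized so that it continues the Eisenstein series of weight one. -/
def thetaIntegral (s : ℂ) : ℂ :=
  (Real.pi : ℂ) ^ (s + 1) * (Complex.Gamma (s + 1))⁻¹ * mellin (theta τ α) (s + 1)

theorem differentiable_thetaIntegral : Differentiable ℂ (thetaIntegral τ α) := by
  have hs : Differentiable ℂ fun s : ℂ => s + 1 := by fun_prop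
  have hpi : (Real.pi : ℂ) ≠ 0 := by exact_mod_cast Real.pi_ne_zero
  exact ((hs.const_cpow (.inl hpi)).mul
    (Complex.differentiable_one_div_Gamma.comp hs)).mul ((differentiable_mellin_theta τ α).comp hs)

theorem isEisensteinContinuation_thetaIntegral :
    IsEisensteinContinuation 1 τ α (thetaIntegral τ α) := by
  refine ⟨differentiable_thetaIntegral τ α, fun s hs => ?_⟩
  have hs : 1 / 2 < s.re := by norm_num at hs; linarith
  have hs1 : 0 < (s + 1).re := by simp; linarith
  have h := hasSum_mellin_pi_mul (a := fun ω : lattice τ => (starRingEnd ℂ) (α + ω))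
    (q := fun ω : lattice τ => ‖α + ω‖ ^ 2) (F := theta τ α) (s := s + 1)
    (fun ω => ?_) hs1 (fun t ht => by simpa using hasSum_theta τ α ht) ?_
  · refine (h.mul_left ((Real.pi : ℂ) ^ (s + 1) * (Complex.Gamma (s + 1))⁻¹)).congr_fun
      fun ω => ?_
    have hpi : (Real.pi : ℂ) ^ (s + 1) ≠ 0 := by
      simp [Complex.cpow_eq_zero_iff, Real.pi_ne_zero]
    have hG := Complex.Gamma_ne_zero_of_re_pos hs1
    unfold eisensteinTerm
    split_ifs with hw
    · simp [hw]
    · have hn : (‖α + ω‖ : ℂ) ≠ 0 := by simpa using hw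
      have hc : (starRingEnd ℂ) (α + ω) ≠ 0 := by simpa only [ne_eq, map_eq_zero] using hw
      -- This is the reason for the shift to s + 1: conj(w)/|w|^(2s+2) = 1/(w|w|^(2s)).
      have hsq : ((‖α + ω‖ ^ 2 : ℝ) : ℂ) ^ (s + 1) =
          ((α + ω) * (starRingEnd ℂ) (α + ω)) * (‖α + ω‖ : ℂ) ^ (2 * s) := by
        rw [Complex.mul_conj, Complex.normSq_eq_norm_sq, Complex.cpow_add _ _ (by simpa using hw),
          Complex.cpow_one, mul_comm]
        congr 1
        push_cast
        rw [← Complex.cpow_nat_mul']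
        · norm_num
        · simp [Complex.arg_ofReal_of_nonneg, Real.pi_pos]
        · simp [Complex.arg_ofReal_of_nonneg, Real.pi_pos.le]
      have hp : (‖α + ω‖ : ℂ) ^ (2 * s) ≠ 0 := by
        simp [Complex.cpow_eq_zero_iff, hw]
      rw [hsq, Complex.cpow_neg, pow_one]
      field_simp
  · rcases eq_or_ne (α + ω) 0 with hw | hw
    · left; simp [hw]
    · right; positivity
  · have hr : 1 - 2 * (s.re + 1) < -2 := by linarith
    refine (summable_norm_add_rpow τ α hr).congr fun ω => ?_
    rw [RCLike.norm_conj, ← Real.rpow_natCast, ← Real.rpow_mul (norm_nonneg _)]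
    rcases (norm_nonneg (α + ω)).eq_or_lt with hw | hw
    · rw [← hw, zero_div, Real.zero_rpow (by linarith)]
    · rw [Real.rpow_sub hw, Real.rpow_one]
      simp

variable {τ α} in
theorem IsEisensteinContinuation.unique {j : ℕ} {F G : ℂ → ℂ}
    (hF : IsEisensteinContinuation j τ α F) (hG : IsEisensteinContinuation j τ α G) : F = G := by
  have hopen : IsOpen {s : ℂ | 1 - (j : ℝ) / 2 < s.re} :=
    isOpen_lt continuous_const Complex.continuous_re
  refine AnalyticOnNhd.eq_of_eventuallyEq (fun s _ => hF.1.analyticAt s)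
    (fun s _ => hG.1.analyticAt s) (z₀ := ((1 - (j : ℝ) / 2 + 1 : ℝ) : ℂ)) ?_
  filter_upwards [hopen.mem_nhds (by simp)] with s hs
  exact (hF.2 s hs).unique (hG.2 s hs)

theorem isEisensteinContinuation_eisenstein :
    IsEisensteinContinuation 1 τ α (eisenstein 1 τ α) := by
  have h : ∃ F, IsEisensteinContinuation 1 τ α F := ⟨_, isEisensteinContinuation_thetaIntegral τ α⟩
  unfold eisenstein
  rw [dif_pos h]
  exact h.choose_spec

theorem eisenstein_one_eq_thetaIntegral : eisenstein 1 τ α = thetaIntegral τ α :=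
  (isEisensteinContinuation_eisenstein τ α).unique (isEisensteinContinuation_thetaIntegral τ α)

theorem eisenstein_one_neg : eisenstein 1 τ (-α) = -eisenstein 1 τ α := by
  refine (isEisensteinContinuation_eisenstein τ (-α)).unique
    ⟨(isEisensteinContinuation_eisenstein τ α).1.neg, fun s hs => ?_⟩
  have h := ((Equiv.neg (lattice τ)).hasSum_iff.mpr
    ((isEisensteinContinuation_eisenstein τ α).2 s hs)).neg
  refine h.congr_fun fun ω => ?_
  have hw : α - ω = -(-α + ω) := by ring
  simp only [eisensteinTerm, Function.comp_apply, Equiv.neg_apply, Submodule.coe_neg,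
    ← sub_eq_add_neg, hw, neg_eq_zero, norm_neg, pow_one]
  split_ifs
  · simp
  · rw [neg_mul, div_neg, neg_neg]

/-! ### The value at s = 0 as a Gaussian-regularized sum -/

theorem integral_Ioi_thetaTerm (w : ℂ) (ε : ℝ) :
    ∫ t in Set.Ioi ε, (starRingEnd ℂ) w * (Real.exp (-Real.pi * ‖w‖ ^ 2 * t) : ℝ) =
      (Real.pi : ℂ)⁻¹ * ((Real.exp (-Real.pi * ‖w‖ ^ 2 * ε) : ℝ) / w) := by
  rcases eq_or_ne w 0 with rfl | hw
  · simp
  have hn : 0 < ‖w‖ := norm_pos_iff.mpr hw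
  have ha : -Real.pi * ‖w‖ ^ 2 < 0 := by
    have := mul_pos Real.pi_pos (pow_pos hn 2)
    linarith
  rw [MeasureTheory.integral_const_mul, integral_complex_ofReal, integral_exp_mul_Ioi ha]
  have hc : w * (starRingEnd ℂ) w = ((‖w‖ ^ 2 : ℝ) : ℂ) := by
    rw [Complex.mul_conj, Complex.normSq_eq_norm_sq]
  have hc0 : (starRingEnd ℂ) w ≠ 0 := by simpa using hw
  have hpi : (Real.pi : ℂ) ≠ 0 := by exact_mod_cast Real.pi_ne_zero
  have : ((-Real.exp (-Real.pi * ‖w‖ ^ 2 * ε) / (-Real.pi * ‖w‖ ^ 2) : ℝ) : ℂ) =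
      (Real.exp (-Real.pi * ‖w‖ ^ 2 * ε) : ℝ) / (Real.pi * (w * (starRingEnd ℂ) w)) := by
    rw [hc, neg_mul, neg_div_neg_eq]
    push_cast
    rfl
  rw [this]
  field_simp

open MeasureTheory in
theorem integrableOn_Ioi_thetaTerm (w : ℂ) (ε : ℝ) :
    IntegrableOn (fun t : ℝ => (starRingEnd ℂ) w * (Real.exp (-Real.pi * ‖w‖ ^ 2 * t) : ℝ))
      (Set.Ioi ε) := by
  rcases eq_or_ne w 0 with rfl | hw
  · simp
  have ha : -Real.pi * ‖w‖ ^ 2 < 0 := by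
    have := mul_pos Real.pi_pos (pow_pos (norm_pos_iff.mpr hw) 2)
    linarith
  exact ((integrableOn_exp_mul_Ioi ha ε).ofReal).const_mul _

theorem exp_neg_pi_sq_mul_le_zpow {r t : ℝ} (hr : 0 < r) (ht : 0 < t) :
    Real.exp (-Real.pi * r ^ 2 * t) ≤ 2 * r ^ (-4 : ℤ) * (t ^ 2)⁻¹ := by
  have h := mul_exp_neg_pi_sq_mul_le hr.le ht 2
  rw [← mul_le_mul_iff_right₀ hr]
  refine h.trans (le_of_eq ?_)
  have : r ^ (1 - 2 * (2 : ℕ) : ℤ) = r * r ^ (-4 : ℤ) := by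
    rw [← zpow_one_add₀ hr.ne']
    norm_num
  rw [this, Nat.factorial_two]
  push_cast
  ring

theorem summable_exp_mul_of_norm_le {t C : ℝ} (ht : 0 < t) (h : ℂ → ℂ) (h0 : h 0 = 0)
    (hC : ∀ w ≠ 0, ‖h w‖ ≤ C * (1 + ‖w‖ ^ (-2 : ℤ))) :
    Summable fun ω : lattice τ => (Real.exp (-Real.pi * ‖(ω : ℂ)‖ ^ 2 * t) : ℂ) * h ω := by
  have hs (n : ℤ) (hn : n < -2) : Summable fun ω : lattice τ => ‖(ω : ℂ)‖ ^ n := by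
    simpa using summable_norm_add_zpow τ 0 hn
  refine Summable.of_norm_bounded (((hs (-4) (by norm_num)).add (hs (-6) (by norm_num))).mul_left
    (2 * (t ^ 2)⁻¹ * C)) fun ω => ?_
  rcases eq_or_ne (ω : ℂ) 0 with hw | hw
  · simp [hw, h0]
  have hr := norm_pos_iff.mpr hw
  rw [norm_mul, Complex.norm_real, Real.norm_of_nonneg (Real.exp_pos _).le]
  calc _ ≤ 2 * ‖(ω : ℂ)‖ ^ (-4 : ℤ) * (t ^ 2)⁻¹ * (C * (1 + ‖(ω : ℂ)‖ ^ (-2 : ℤ))) := by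
        gcongr
        · exact exp_neg_pi_sq_mul_le_zpow hr ht
        · exact hC _ hw
    _ = _ := by
        rw [show (-6 : ℤ) = -4 + -2 by norm_num, zpow_add₀ hr.ne']
        ring

-- The cutoff ε > 0 makes the integrals of the norms O(|α+ω|^(-5)), so sum and integral may be
-- exchanged. Over (0, ∞) they would only be of size 1/|α+ω|, which is not summable.
open MeasureTheory in
theorem hasSum_exp_div {ε : ℝ} (hε : 0 < ε) :
    HasSum (fun ω : lattice τ => ((Real.exp (-Real.pi * ‖α + ω‖ ^ 2 * ε) : ℝ) : ℂ) / (α + ω))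
      (Real.pi * ∫ t in Set.Ioi ε, theta τ α t) := by
  have hpi : (Real.pi : ℂ) ≠ 0 := by exact_mod_cast Real.pi_ne_zero
  have hsum : Summable fun ω : lattice τ => ∫ t in Set.Ioi ε,
      ‖(starRingEnd ℂ) (α + ω) * ((Real.exp (-Real.pi * ‖α + ω‖ ^ 2 * t) : ℝ) : ℂ)‖ := by
    have hb : Summable fun ω : lattice τ => Real.pi⁻¹ * (2 * ‖α + ω‖ ^ (-5 : ℤ) * (ε ^ 2)⁻¹) :=
      (((summable_norm_add_zpow τ α (n := -5) (by norm_num)).mul_left 2).mul_right _).mul_left _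
    refine Summable.of_nonneg_of_le (fun ω => integral_nonneg fun t => norm_nonneg _)
      (fun ω => ?_) hb
    simp only [norm_thetaTerm]
    rcases eq_or_ne (α + ω) 0 with hw | hw
    · simp [hw]
    have hr := norm_pos_iff.mpr hw
    have ha : -Real.pi * ‖α + ω‖ ^ 2 < 0 := by
      have := mul_pos Real.pi_pos (pow_pos hr 2)
      linarith
    rw [integral_const_mul, integral_exp_mul_Ioi ha, neg_mul Real.pi, neg_div_neg_eq]
    have h := exp_neg_pi_sq_mul_le_zpow hr hε
    rw [neg_mul Real.pi] at h
    calc _ ≤ ‖α + ω‖ * (2 * ‖α + ω‖ ^ (-4 : ℤ) * (ε ^ 2)⁻¹ / (Real.pi * ‖α + ω‖ ^ 2)) := by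
          gcongr
      _ = _ := by
          rw [show (-5 : ℤ) = -4 + -1 by norm_num, zpow_add₀ hr.ne', zpow_neg_one]
          field_simp
  have h := hasSum_integral_of_summable_integral_norm (μ := volume.restrict (Set.Ioi ε))
    (fun ω : lattice τ => integrableOn_Ioi_thetaTerm (α + ω) ε) hsum
  refine (h.mul_left (Real.pi : ℂ)).congr_fun fun ω => ?_
  rw [integral_Ioi_thetaTerm, mul_inv_cancel_left₀ hpi]

open MeasureTheory Filter Topology in
theorem tendsto_tsum_exp_div :
    Tendsto (fun ε : ℝ => ∑' ω : lattice τ,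
      ((Real.exp (-Real.pi * ‖α + ω‖ ^ 2 * ε) : ℝ) : ℂ) / (α + ω)) (𝓝[>] 0)
      (𝓝 (eisenstein 1 τ α 0)) := by
  have hint : IntegrableOn (theta τ α) (Set.Ioi 0) := by
    simpa [MellinConvergent] using mellinConvergent_theta τ α 1
  have h := ((aecover_Ioi_of_Ioi (μ := volume) (A := (0 : ℝ)) (l := 𝓝[>] (0 : ℝ)) (a := id)
    (tendsto_id'.mpr nhdsWithin_le_nhds)).integral_tendsto_of_countably_generated hint).const_mul
    (Real.pi : ℂ)
  have hval : eisenstein 1 τ α 0 = Real.pi * ∫ t in Set.Ioi 0, theta τ α t := by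
    rw [eisenstein_one_eq_thetaIntegral]
    simp [thetaIntegral, mellin]
  rw [hval]
  refine h.congr' ?_
  filter_upwards [self_mem_nhdsWithin] with ε hε
  have hε : 0 < ε := hε
  rw [(hasSum_exp_div τ α hε).tsum_eq, Measure.restrict_restrict measurableSet_Ioi, id_eq,
    Set.inter_eq_left.mpr (Set.Ioi_subset_Ioi hε.le)]

/-! ### Comparison with the Weierstrass zeta function -/

variable {τ α} in
theorem norm_zetaTerm_le (hα : α ∉ lattice τ) (ω : lattice τ) :
    ‖1 / (α + ω) - 1 / ω + α / (ω : ℂ) ^ 2‖ ≤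
      ‖α‖ ^ 2 * (‖(ω : ℂ)‖ ^ (-3 : ℤ) + ‖α + ω‖ ^ (-3 : ℤ)) := by
  have hα0 : α ≠ 0 := fun h => hα (h ▸ zero_mem _)
  have hw : α + ω ≠ 0 := fun h => hα (by
    rw [eq_neg_of_add_eq_zero_left h]
    exact neg_mem ω.2)
  rcases eq_or_ne (ω : ℂ) 0 with h0 | h0
  · have : 0 < ‖α‖ := norm_pos_iff.mpr hα0
    simp only [h0, add_zero, div_zero, sub_zero, zero_pow two_ne_zero, norm_div, norm_one,
      norm_zero]
    rw [zero_zpow _ (by norm_num), zero_add, zpow_neg]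
    refine le_of_eq ?_
    norm_cast
    field_simp
  · have heq : 1 / (α + ω) - 1 / ω + α / (ω : ℂ) ^ 2 =
        α ^ 2 * (((ω : ℂ)⁻¹) ^ 2 * (α + ω)⁻¹) := by
      field_simp
      ring
    -- Separates the mixed product |ω|^(-2)|α+ω|^(-1) into two summable cubes.
    have key {a b : ℝ} (ha : 0 ≤ a) (hb : 0 ≤ b) : a ^ 2 * b ≤ a ^ 3 + b ^ 3 := by
      rcases le_total a b with h | h
      · nlinarith [mul_le_mul h h ha hb, mul_nonneg hb (sub_nonneg.mpr (mul_le_mul h h ha hb)),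
          pow_nonneg ha 3]
      · nlinarith [mul_nonneg (sq_nonneg a) (sub_nonneg.mpr h), pow_nonneg hb 3]
    rw [heq, norm_mul, norm_pow, norm_mul, norm_pow, norm_inv, norm_inv, zpow_neg, zpow_neg,
      ← inv_zpow, ← inv_zpow]
    gcongr
    exact_mod_cast key (inv_nonneg.mpr (norm_nonneg _)) (inv_nonneg.mpr (norm_nonneg _))

theorem summable_norm_zpow_add :
    Summable fun ω : lattice τ =>
      ‖α‖ ^ 2 * (‖(ω : ℂ)‖ ^ (-3 : ℤ) + ‖α + ω‖ ^ (-3 : ℤ)) := by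
  have h0 := summable_norm_add_zpow τ 0 (n := -3) (by norm_num)
  simp only [zero_add] at h0
  exact (h0.add (summable_norm_add_zpow τ α (by norm_num))).mul_left _

variable {τ α} in
theorem summable_zetaTerm (hα : α ∉ lattice τ) :
    Summable fun ω : lattice τ => 1 / (α + ω) - 1 / ω + α / (ω : ℂ) ^ 2 :=
  Summable.of_norm_bounded (summable_norm_zpow_add τ α) (norm_zetaTerm_le hα)

-- Substitute ω ↦ -ω. With division by zero equal to 0, the term ω = 0 is exactly the leading 1/α.
variable {τ α} in
theorem zeta_eq_tsum (hα : α ∉ lattice τ) :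
    zeta τ α = ∑' ω : lattice τ, (1 / (α + ω) - 1 / ω + α / (ω : ℂ) ^ 2) := by
  have hf : (fun ω : lattice τ => 1 / (α + ω) - 1 / ω + α / (ω : ℂ) ^ 2) ∘ Equiv.neg _ =
      fun ω : lattice τ => 1 / (α - ω) + 1 / ω + α / (ω : ℂ) ^ 2 := by
    funext ω
    simp [sub_eq_add_neg, div_eq_mul_inv, inv_neg]
  have hs := (Equiv.summable_iff (Equiv.neg (lattice τ))).mpr (summable_zetaTerm hα)
  rw [← (Equiv.neg (lattice τ)).tsum_eq]
  change _ = tsum ((fun ω : lattice τ => 1 / (α + ω) - 1 / ω + α / (ω : ℂ) ^ 2) ∘ Equiv.neg _)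
  rw [hf] at hs ⊢
  rw [zeta, hs.tsum_eq_add_tsum_ite 0]
  congr 1
  · simp
  · rw [show (∑' ω : {ω : lattice τ // ω ≠ 0}, (1 / (α - (ω.1 : ℂ)) + 1 / (ω.1 : ℂ) +
      α / (ω.1 : ℂ) ^ 2)) = _ from tsum_subtype {ω : lattice τ | ω ≠ 0}
        fun ω : lattice τ => 1 / (α - ω) + 1 / ω + α / (ω : ℂ) ^ 2]
    refine tsum_congr fun ω => ?_
    by_cases h : ω = 0 <;> simp [h]

/-- The exponent `2 π ε Re (α conj ω)` in `exp (-π ε |α + ω|²)`. -/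
def crossTerm (α : ℂ) (ε : ℝ) (ω : ℂ) : ℝ :=
  2 * Real.pi * ε * (α * (starRingEnd ℂ) ω).re

/-- The part of `exp (-X) (1 / ω - α / ω²)` of second order in `α`, with `X` the cross term. -/
def quadraticPart (α : ℂ) (ε : ℝ) (ω : ℂ) : ℂ :=
  (Real.exp (-crossTerm α ε ω) - 1 + crossTerm α ε ω : ℝ) / ω -
    α / ω ^ 2 * (Real.exp (-crossTerm α ε ω) - 1 : ℝ)

/-- The part of `exp (-X) (1 / ω - α / ω²)` that is linear in `α`, with `X` the cross term. -/
def linearPart (α : ℂ) (ε : ℝ) (ω : ℂ) : ℂ :=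
  -(crossTerm α ε ω : ℂ) / ω - α / ω ^ 2

theorem linearPart_add_smul (x y : ℝ) (β γ : ℂ) (ε : ℝ) (ω : ℂ) :
    linearPart (x * β + y * γ) ε ω = x * linearPart β ε ω + y * linearPart γ ε ω := by
  have : crossTerm (x * β + y * γ) ε ω = x * crossTerm β ε ω + y * crossTerm γ ε ω := by
    simp [crossTerm]
    ring
  rw [linearPart, this, linearPart, linearPart]
  push_cast
  ring

theorem abs_crossTerm_le {ε : ℝ} (hε : 0 ≤ ε) (ω : ℂ) :
    |crossTerm α ε ω| ≤ 2 * Real.pi * ε * (‖α‖ * ‖ω‖) := by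
  have hp : 0 ≤ 2 * Real.pi * ε := by positivity
  rw [crossTerm, abs_mul, abs_of_nonneg hp]
  gcongr
  exact (Complex.abs_re_le_norm _).trans (by simp)

theorem exp_norm_add_sq (ε : ℝ) (ω : ℂ) :
    Real.exp (-Real.pi * ‖α + ω‖ ^ 2 * ε) = Real.exp (-Real.pi * ‖α‖ ^ 2 * ε) *
      (Real.exp (-Real.pi * ‖ω‖ ^ 2 * ε) * Real.exp (-crossTerm α ε ω)) := by
  rw [← Real.exp_add, ← Real.exp_add, crossTerm, Complex.sq_norm, Complex.sq_norm, Complex.sq_norm,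
    Complex.normSq_add]
  ring_nf

/-- The splitting used for the limit ε → 0. It holds for every ω, including ω = 0 and ω = -α, by the
convention for division by zero. -/
theorem exp_div_eq (ε : ℝ) (ω : ℂ) :
    ((Real.exp (-Real.pi * ‖α + ω‖ ^ 2 * ε) : ℝ) : ℂ) / (α + ω) =
      (Real.exp (-Real.pi * ‖α + ω‖ ^ 2 * ε) : ℝ) * (1 / (α + ω) - 1 / ω + α / ω ^ 2) +
      (Real.exp (-Real.pi * ‖α‖ ^ 2 * ε) : ℝ) *
        ((Real.exp (-Real.pi * ‖ω‖ ^ 2 * ε) : ℝ) * quadraticPart α ε ω +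
          ((Real.exp (-Real.pi * ‖ω‖ ^ 2 * ε) : ℝ) * ω⁻¹ +
            (Real.exp (-Real.pi * ‖ω‖ ^ 2 * ε) : ℝ) * linearPart α ε ω)) := by
  rw [exp_norm_add_sq, quadraticPart, linearPart]
  push_cast
  ring

theorem abs_exp_sub_one_le_mul (x : ℝ) : |Real.exp x - 1| ≤ |x| * Real.exp |x| := by
  have h := Complex.norm_exp_sub_sum_le_norm_mul_exp x 1
  simp only [Finset.sum_range_one, pow_zero, Nat.factorial_zero, Nat.cast_one, div_one,
    pow_one, Complex.norm_real, Real.norm_eq_abs] at h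
  rwa [← Complex.ofReal_exp, ← Complex.ofReal_one, ← Complex.ofReal_sub, Complex.norm_real,
    Real.norm_eq_abs] at h

theorem abs_exp_sub_one_sub_le_mul (x : ℝ) :
    |Real.exp x - 1 - x| ≤ |x| ^ 2 * Real.exp |x| := by
  have h := Complex.norm_exp_sub_sum_le_norm_mul_exp x 2
  simp only [Finset.sum_range_succ, Finset.sum_range_zero, zero_add, pow_zero, Nat.factorial_zero,
    Nat.cast_one, div_one, pow_one, Nat.factorial_one, Complex.norm_real, Real.norm_eq_abs] at h
  rwa [← Complex.ofReal_exp, ← Complex.ofReal_one, ← Complex.ofReal_add, ← Complex.ofReal_sub,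
    Complex.norm_real, Real.norm_eq_abs, ← sub_sub] at h

-- A majorant independent of ε. With u = ε|ω|² the two pieces are of size u²|ω|^(-3) and u|ω|^(-3),
-- and the Gaussian absorbs the powers of u.
open Real in
theorem norm_exp_mul_quadraticPart_le {ε : ℝ} (hε : 0 < ε) (hε1 : ε ≤ 1) (ω : ℂ) :
    ‖((rexp (-π * ‖ω‖ ^ 2 * ε) : ℝ) : ℂ) * quadraticPart α ε ω‖ ≤
      (8 * π ^ 2 + 2 * π) * ‖α‖ ^ 2 * rexp (2 * π * ‖α‖ ^ 2) * ‖ω‖ ^ (-3 : ℤ) := by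
  rcases eq_or_ne ω 0 with rfl | hω
  · simp [quadraticPart]
  have hr : 0 < ‖ω‖ := norm_pos_iff.mpr hω
  set r := ‖ω‖
  set A := ‖α‖
  have hA : 0 ≤ A := norm_nonneg α
  set X := crossTerm α ε ω
  have hX : |X| ≤ 2 * π * ε * (A * r) := abs_crossTerm_le α hε.le ω
  have hq : ‖quadraticPart α ε ω‖ ≤
      ((2 * π * ε * (A * r)) ^ 2 / r + A / r ^ 2 * (2 * π * ε * (A * r))) * rexp |X| := by
    refine (norm_sub_le _ _).trans ?_
    rw [norm_div, norm_mul, norm_div, norm_pow, Complex.norm_real, Complex.norm_real,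
      Real.norm_eq_abs, Real.norm_eq_abs, add_mul]
    have h1 := abs_exp_sub_one_sub_le_mul (-X)
    have h2 := abs_exp_sub_one_le_mul (-X)
    rw [abs_neg] at h1 h2
    rw [sub_neg_eq_add] at h1
    refine add_le_add ?_ ?_
    · rw [div_mul_eq_mul_div]
      refine div_le_div_of_nonneg_right (h1.trans ?_) hr.le
      gcongr
    · rw [mul_assoc (A / r ^ 2)]
      refine mul_le_mul_of_nonneg_left (h2.trans ?_) (by positivity)
      gcongr
  have hexp : rexp (-π * r ^ 2 * ε) * rexp |X| ≤
      rexp (2 * π * A ^ 2) * rexp (-(ε * r ^ 2)) := by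
    rw [← Real.exp_add, ← Real.exp_add, Real.exp_le_exp]
    -- The cross term 2πε‖α‖r is at most 2πε‖α‖² + πεr²/2, so half of the Gaussian survives; π/2 ≥ 1
    -- and ε ≤ 1 do the rest.
    have h1 : 0 ≤ π * ε * (2 * A - r) ^ 2 := by positivity
    have h2 : 0 ≤ (π / 2 - 1) * (ε * r ^ 2) :=
      mul_nonneg (by linarith [two_le_pi]) (by positivity)
    have h3 : 0 ≤ 2 * π * A ^ 2 * (1 - ε) := mul_nonneg (by positivity) (by linarith)
    nlinarith
  have hu1 : ε * r ^ 2 * rexp (-(ε * r ^ 2)) ≤ 1 := by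
    have := Real.pow_div_factorial_le_exp (ε * r ^ 2) (by positivity) 1
    rw [Real.exp_neg, ← div_eq_mul_inv, div_le_one (Real.exp_pos _)]
    simpa using this
  have hu2 : (ε * r ^ 2) ^ 2 * rexp (-(ε * r ^ 2)) ≤ 2 := by
    have := Real.pow_div_factorial_le_exp (ε * r ^ 2) (by positivity) 2
    rw [Real.exp_neg, ← div_eq_mul_inv, div_le_iff₀ (Real.exp_pos _)]
    rw [Nat.factorial_two] at this
    push_cast at this
    linarith
  rw [norm_mul, Complex.norm_real, Real.norm_of_nonneg (Real.exp_pos _).le]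
  calc _ ≤ rexp (-π * r ^ 2 * ε) * (((2 * π * ε * (A * r)) ^ 2 / r +
        A / r ^ 2 * (2 * π * ε * (A * r))) * rexp |X|) := by gcongr
    _ = ((2 * π * ε * (A * r)) ^ 2 / r + A / r ^ 2 * (2 * π * ε * (A * r))) *
        (rexp (-π * r ^ 2 * ε) * rexp |X|) := by ring
    _ ≤ ((2 * π * ε * (A * r)) ^ 2 / r + A / r ^ 2 * (2 * π * ε * (A * r))) *
        (rexp (2 * π * A ^ 2) * rexp (-(ε * r ^ 2))) := by gcongr
    _ = (4 * π ^ 2 * ((ε * r ^ 2) ^ 2 * rexp (-(ε * r ^ 2))) +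
          2 * π * (ε * r ^ 2 * rexp (-(ε * r ^ 2)))) *
        (A ^ 2 * rexp (2 * π * A ^ 2) * r ^ (-3 : ℤ)) := by
      rw [zpow_neg]
      norm_cast
      field_simp
      ring
    _ ≤ (4 * π ^ 2 * 2 + 2 * π * 1) * (A ^ 2 * rexp (2 * π * A ^ 2) * r ^ (-3 : ℤ)) := by gcongr
    _ = _ := by ring

theorem summable_exp_mul_quadraticPart {ε : ℝ} (hε : 0 < ε) (hε1 : ε ≤ 1) :
    Summable fun ω : lattice τ =>
      ((Real.exp (-Real.pi * ‖(ω : ℂ)‖ ^ 2 * ε) : ℝ) : ℂ) * quadraticPart α ε ω := by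
  have h0 := summable_norm_add_zpow τ 0 (n := -3) (by norm_num)
  simp only [zero_add] at h0
  exact Summable.of_norm_bounded (h0.mul_left _)
    fun ω => norm_exp_mul_quadraticPart_le α hε hε1 ω

open Filter Topology in
theorem tendsto_tsum_quadraticPart :
    Tendsto (fun ε : ℝ => ∑' ω : lattice τ,
      ((Real.exp (-Real.pi * ‖(ω : ℂ)‖ ^ 2 * ε) : ℝ) : ℂ) * quadraticPart α ε ω) (𝓝[>] 0)
      (𝓝 0) := by
  have h0 := summable_norm_add_zpow τ 0 (n := -3) (by norm_num)
  simp only [zero_add] at h0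
  rw [← tsum_zero (α := ℂ) (β := lattice τ)]
  refine tendsto_tsum_of_dominated_convergence (h0.mul_left
    ((8 * Real.pi ^ 2 + 2 * Real.pi) * ‖α‖ ^ 2 * Real.exp (2 * Real.pi * ‖α‖ ^ 2)))
    (fun ω => ?_) ?_
  · have hc : Continuous fun ε : ℝ =>
        ((Real.exp (-Real.pi * ‖(ω : ℂ)‖ ^ 2 * ε) : ℝ) : ℂ) * quadraticPart α ε ω := by
      unfold quadraticPart crossTerm
      fun_prop
    exact (hc.tendsto' 0 0 (by simp [quadraticPart, crossTerm])).mono_left nhdsWithin_le_nhds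
  · filter_upwards [Ioc_mem_nhdsGT (zero_lt_one (α := ℝ))] with ε hε ω
    exact norm_exp_mul_quadraticPart_le α hε.1 hε.2 ω

theorem summable_exp_mul_linearPart {ε : ℝ} (hε : 0 < ε) :
    Summable fun ω : lattice τ =>
      ((Real.exp (-Real.pi * ‖(ω : ℂ)‖ ^ 2 * ε) : ℝ) : ℂ) * linearPart α ε ω := by
  refine summable_exp_mul_of_norm_le τ (C := 2 * Real.pi * ε * ‖α‖ + ‖α‖) hε (linearPart α ε)
    (by simp [linearPart]) fun w hw => ?_
  have hr := norm_pos_iff.mpr hw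
  refine (norm_sub_le _ _).trans ?_
  rw [norm_div, norm_neg, Complex.norm_real, Real.norm_eq_abs, norm_div, norm_pow]
  have h1 : |crossTerm α ε w| / ‖w‖ ≤ 2 * Real.pi * ε * ‖α‖ := by
    rw [div_le_iff₀ hr]
    exact (abs_crossTerm_le α hε.le w).trans (le_of_eq (by ring))
  have h2 : ‖α‖ / ‖w‖ ^ 2 = ‖α‖ * ‖w‖ ^ (-2 : ℤ) := by
    rw [zpow_neg, div_eq_mul_inv]
    norm_cast
  have h3 : 0 ≤ 2 * Real.pi * ε * ‖α‖ * ‖w‖ ^ (-2 : ℤ) := by positivity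
  have h4 := norm_nonneg α
  linarith

theorem summable_exp_mul_inv {ε : ℝ} (hε : 0 < ε) :
    Summable fun ω : lattice τ =>
      ((Real.exp (-Real.pi * ‖(ω : ℂ)‖ ^ 2 * ε) : ℝ) : ℂ) * (ω : ℂ)⁻¹ := by
  refine summable_exp_mul_of_norm_le τ (C := 1) hε (fun w => w⁻¹) inv_zero fun w hw => ?_
  have hr := norm_pos_iff.mpr hw
  rw [norm_inv, one_mul, zpow_neg]
  norm_cast
  rw [← inv_pow]
  nlinarith [sq_nonneg (‖w‖⁻¹ - 1), inv_pos.mpr hr]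

theorem tsum_exp_mul_inv (ε : ℝ) :
    ∑' ω : lattice τ, ((Real.exp (-Real.pi * ‖(ω : ℂ)‖ ^ 2 * ε) : ℝ) : ℂ) * (ω : ℂ)⁻¹ = 0 := by
  refine self_eq_neg.mp ?_
  rw [← tsum_neg, ← (Equiv.neg (lattice τ)).tsum_eq]
  refine tsum_congr fun ω => ?_
  simp [inv_neg]

variable {τ α} in
theorem tsum_exp_div_eq (hα : α ∉ lattice τ) {ε : ℝ} (hε : 0 < ε) (hε1 : ε ≤ 1) :
    ∑' ω : lattice τ, ((Real.exp (-Real.pi * ‖α + ω‖ ^ 2 * ε) : ℝ) : ℂ) / (α + ω) =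
      (∑' ω : lattice τ, ((Real.exp (-Real.pi * ‖α + ω‖ ^ 2 * ε) : ℝ) : ℂ) *
        (1 / (α + ω) - 1 / ω + α / (ω : ℂ) ^ 2)) +
      (Real.exp (-Real.pi * ‖α‖ ^ 2 * ε) : ℝ) *
        ((∑' ω : lattice τ, ((Real.exp (-Real.pi * ‖(ω : ℂ)‖ ^ 2 * ε) : ℝ) : ℂ) *
          quadraticPart α ε ω) +
        ∑' ω : lattice τ, ((Real.exp (-Real.pi * ‖(ω : ℂ)‖ ^ 2 * ε) : ℝ) : ℂ) *
          linearPart α ε ω) := by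
  have hz : Summable fun ω : lattice τ => ((Real.exp (-Real.pi * ‖α + ω‖ ^ 2 * ε) : ℝ) : ℂ) *
      (1 / (α + ω) - 1 / ω + α / (ω : ℂ) ^ 2) := by
    refine Summable.of_norm_bounded (summable_norm_zpow_add τ α) fun ω => ?_
    rw [norm_mul, Complex.norm_real, Real.norm_of_nonneg (Real.exp_pos _).le]
    refine (mul_le_of_le_one_left (norm_nonneg _) (Real.exp_le_one_iff.mpr ?_)).trans
      (norm_zetaTerm_le hα ω)
    have : 0 ≤ Real.pi * ‖α + ω‖ ^ 2 * ε := by positivity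
    linarith
  have hq := summable_exp_mul_quadraticPart τ α hε hε1
  have hi := summable_exp_mul_inv τ hε
  have hl := summable_exp_mul_linearPart τ α hε
  simp_rw [exp_div_eq]
  rw [hz.tsum_add ((hq.add (hi.add hl)).mul_left _), tsum_mul_left, hq.tsum_add (hi.add hl),
    hi.tsum_add hl, tsum_exp_mul_inv, zero_add]

open Filter Topology in
variable {τ α} in
theorem tendsto_tsum_exp_mul_zetaTerm (hα : α ∉ lattice τ) :
    Tendsto (fun ε : ℝ => ∑' ω : lattice τ, ((Real.exp (-Real.pi * ‖α + ω‖ ^ 2 * ε) : ℝ) : ℂ) *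
        (1 / (α + ω) - 1 / ω + α / (ω : ℂ) ^ 2)) (𝓝[>] 0) (𝓝 (zeta τ α)) := by
  rw [zeta_eq_tsum hα]
  refine tendsto_tsum_of_dominated_convergence (summable_norm_zpow_add τ α) (fun ω => ?_) ?_
  · have hc : Continuous fun ε : ℝ => ((Real.exp (-Real.pi * ‖α + ω‖ ^ 2 * ε) : ℝ) : ℂ) *
        (1 / (α + ω) - 1 / ω + α / (ω : ℂ) ^ 2) := by fun_prop
    exact (hc.tendsto' 0 _ (by simp)).mono_left nhdsWithin_le_nhds
  · filter_upwards [self_mem_nhdsWithin] with ε hε ω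
    have hε : 0 < ε := hε
    rw [norm_mul, Complex.norm_real, Real.norm_of_nonneg (Real.exp_pos _).le]
    refine (mul_le_of_le_one_left (norm_nonneg _) (Real.exp_le_one_iff.mpr ?_)).trans
      (norm_zetaTerm_le hα ω)
    have : 0 ≤ Real.pi * ‖α + ω‖ ^ 2 * ε := by positivity
    linarith

-- The limit exists because every other term of `tsum_exp_div_eq` has a known limit; the prefactor
-- exp(-πε|α|²) tends to 1.
open Filter Topology in
variable {τ α} in
theorem tendsto_tsum_linearPart (hα : α ∉ lattice τ) :
    Tendsto (fun ε : ℝ => ∑' ω : lattice τ,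
      ((Real.exp (-Real.pi * ‖(ω : ℂ)‖ ^ 2 * ε) : ℝ) : ℂ) * linearPart α ε ω) (𝓝[>] 0)
      (𝓝 (eisenstein 1 τ α 0 - zeta τ α)) := by
  have hk : Tendsto (fun ε : ℝ => ((Real.exp (-Real.pi * ‖α‖ ^ 2 * ε) : ℝ) : ℂ)⁻¹) (𝓝[>] 0)
      (𝓝 1) := by
    have hc : Continuous fun ε : ℝ => ((Real.exp (-Real.pi * ‖α‖ ^ 2 * ε) : ℝ) : ℂ)⁻¹ := by
      refine Continuous.inv₀ (by fun_prop) fun ε => ?_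
      exact_mod_cast (Real.exp_pos _).ne'
    exact (hc.tendsto' 0 1 (by simp)).mono_left nhdsWithin_le_nhds
  have h := (hk.mul ((tendsto_tsum_exp_div τ α).sub (tendsto_tsum_exp_mul_zetaTerm hα))).sub
    (tendsto_tsum_quadraticPart τ α)
  rw [one_mul, sub_zero] at h
  refine h.congr' ?_
  filter_upwards [Ioc_mem_nhdsGT (zero_lt_one (α := ℝ))] with ε hε
  rw [tsum_exp_div_eq hα hε.1 hε.2, add_sub_cancel_left, inv_mul_cancel_left₀, add_sub_cancel_left]
  exact_mod_cast (Real.exp_pos _).ne'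

/-! ### Real-linearity, half-periods and the final formulas -/

-- Linearity holds for each ε and passes to the limit. The scalars must be real, since the cross
-- term involves Re(α conj ω).
open Filter Topology in
variable {τ} in
theorem eisenstein_one_sub_zeta_linear {x y : ℝ} {β γ : ℂ} (hβ : β ∉ lattice τ)
    (hγ : γ ∉ lattice τ) (h : x * β + y * γ ∉ lattice τ) :
    eisenstein 1 τ (x * β + y * γ) 0 - zeta τ (x * β + y * γ) =
      x * (eisenstein 1 τ β 0 - zeta τ β) + y * (eisenstein 1 τ γ 0 - zeta τ γ) := by
  refine tendsto_nhds_unique (tendsto_tsum_linearPart h)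
    ((((tendsto_tsum_linearPart hβ).const_mul (x : ℂ)).add
      ((tendsto_tsum_linearPart hγ).const_mul (y : ℂ))).congr' ?_)
  filter_upwards [self_mem_nhdsWithin] with ε hε
  have hε : 0 < ε := hε
  rw [← tsum_mul_left, ← tsum_mul_left,
    ← ((summable_exp_mul_linearPart τ β hε).mul_left _).tsum_add
      ((summable_exp_mul_linearPart τ γ hε).mul_left _)]
  refine tsum_congr fun ω => ?_
  rw [linearPart_add_smul]
  ring

/-- Here α and -α are congruent modulo L, so periodicity and oddness give E₁ = -E₁. -/
theorem eisenstein_one_eq_zero_of_two_mul_mem (h : 2 * α ∈ lattice τ) :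
    eisenstein 1 τ α 0 = 0 := by
  have h1 := congrFun (eisenstein_add 1 τ (-α) ⟨2 * α, h⟩) 0
  rw [eisenstein_one_neg, show -α + ((⟨2 * α, h⟩ : lattice τ) : ℂ) = α by simp; ring] at h1
  exact self_eq_neg.mp h1

end Lattice

theorem int_mul_add_int_mem_lattice (τ : ℍ) (m n : ℤ) : (m * τ + n : ℂ) ∈ lattice τ :=
  PeriodPair.mem_lattice.mpr ⟨n, m, by simp [periods, add_comm]⟩

theorem eisenstein_one_apply_zero {τ : ℍ} (x y : ℝ) (h : (x * τ + y : ℂ) ∉ lattice τ) :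
    eisenstein 1 τ (x * τ + y) 0 = zeta τ (x * τ + y) - 2 * x * eta₂ τ - 2 * y * eta₁ τ := by
  have h1 : (1 / 2 : ℂ) ∉ lattice τ := (periods τ).ω₁_div_two_notMem_lattice
  have h2 : (τ / 2 : ℂ) ∉ lattice τ := (periods τ).ω₂_div_two_notMem_lattice
  have e1 : eisenstein 1 τ (1 / 2) 0 = 0 := eisenstein_one_eq_zero_of_two_mul_mem τ _ (by
    simpa using int_mul_add_int_mem_lattice τ 0 1)
  have e2 : eisenstein 1 τ (τ / 2) 0 = 0 := eisenstein_one_eq_zero_of_two_mul_mem τ _ (by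
    simpa [mul_div_cancel₀] using int_mul_add_int_mem_lattice τ 1 0)
  have heq : (x * τ + y : ℂ) = (2 * x : ℝ) * (τ / 2) + (2 * y : ℝ) * (1 / 2) := by
    push_cast
    ring
  have := eisenstein_one_sub_zeta_linear h2 h1 (heq ▸ h)
  rw [← heq, e1, e2, zero_sub, zero_sub, ← eta₁, ← eta₂] at this
  push_cast at this
  linear_combination this

theorem eq_im_div_im_mul_add (τ : ℍ) (z : ℂ) :
    z = ((z.im / τ.im : ℝ) : ℂ) * τ + ((z.re - z.im / τ.im * τ.re : ℝ) : ℂ) := by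
  have hv := τ.im_ne_zero
  apply Complex.ext
  · simp
  · simp [hv]

/-- Compare `eisenstein_one_apply_zero` at z and at the translate: the left sides agree by
periodicity of E₁. -/
theorem zeta_add_int_mul_add_int {τ : ℍ} {z : ℂ} (hz : z ∉ lattice τ) (m n : ℤ) :
    zeta τ (z + m * τ + n) = zeta τ z + 2 * m * eta₂ τ + 2 * n * eta₁ τ := by
  obtain ⟨x, y, rfl⟩ : ∃ x y : ℝ, z = x * τ + y := ⟨_, _, eq_im_div_im_mul_add τ z⟩
  have hω := int_mul_add_int_mem_lattice τ m n
  have heq : (x * τ + y : ℂ) + (m * τ + n) = ((x + m : ℝ) : ℂ) * τ + ((y + n : ℝ) : ℂ) := by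
    push_cast
    ring
  have h1 := eisenstein_one_apply_zero x y hz
  have h2 := eisenstein_one_apply_zero (x + m) (y + n)
    (heq ▸ fun h => hz ((Submodule.add_mem_iff_left _ hω).mp h))
  have h3 := congrFun (eisenstein_add 1 τ (x * τ + y) ⟨_, hω⟩) 0
  rw [show (x * τ + y : ℂ) + ((⟨_, hω⟩ : lattice τ) : ℂ) = _ from heq, h1, h2, ← heq] at h3
  rw [add_assoc]
  push_cast at h3
  linear_combination h3

theorem eisensteinDiv_image_eq_sum_zeta {τ : ℍ} (Dt : ℂ →₀ ℤ)
    (hsum : (Dt.sum fun α m => (m : ℂ) * α) = 0)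
    (hDt : ∀ α ∈ Dt.support, point τ α = 0 → α = 0) :
    eisensteinDiv 1 τ (image τ Dt) 0 = ∑ α ∈ Dt.support.erase 0, (Dt α : ℂ) * zeta τ α := by
  let x : ℂ → ℝ := fun z => z.im / τ.im
  let y : ℂ → ℝ := fun z => z.re - z.im / τ.im * τ.re
  have hxy (z : ℂ) : z = x z * τ + y z := eq_im_div_im_mul_add τ z
  -- As τ and 1 are independent over ℝ, ∑ m_α α = 0 splits into ∑ m_α x_α = 0 and ∑ m_α y_α = 0,
  -- which removes the η₂ and η₁ terms.
  have him : ∑ α ∈ Dt.support, (Dt α : ℝ) * α.im = 0 := by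
    simpa [Finsupp.sum] using congrArg Complex.im hsum
  have hre : ∑ α ∈ Dt.support, (Dt α : ℝ) * α.re = 0 := by
    simpa [Finsupp.sum] using congrArg Complex.re hsum
  have hx : ∑ α ∈ Dt.support, (Dt α : ℝ) * x α = 0 := by
    simp only [x, ← mul_div_assoc]
    rw [← Finset.sum_div, him, zero_div]
  have hy : ∑ α ∈ Dt.support, (Dt α : ℝ) * y α = 0 := by
    have : ∀ α ∈ Dt.support, (Dt α : ℝ) * y α = Dt α * α.re - Dt α * x α * τ.re := by
      intro α _
      simp only [x, y]
      ring
    rw [Finset.sum_congr rfl this, Finset.sum_sub_distrib, ← Finset.sum_mul, hre, hx]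
    simp
  -- The formula through ζ does not apply at 0; there E₁ itself vanishes, so the point 0 may be
  -- dropped from the sum.
  have hzero : eisenstein 1 τ 0 0 = 0 :=
    eisenstein_one_eq_zero_of_two_mul_mem τ 0 (by simp)
  have hterm : ∀ α ∈ Dt.support.erase 0, (Dt α : ℂ) * eisenstein 1 τ α 0 =
      Dt α * zeta τ α - 2 * eta₂ τ * ((Dt α * x α : ℝ) : ℂ) -
        2 * eta₁ τ * ((Dt α * y α : ℝ) : ℂ) := by
    intro α hα
    obtain ⟨h0, hα⟩ := Finset.mem_erase.mp hα
    have hn : α ∉ lattice τ := fun h => h0 (hDt α hα ((Submodule.Quotient.mk_eq_zero _).mpr h))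
    have := eisenstein_one_apply_zero (x α) (y α) (hxy α ▸ hn)
    rw [← hxy] at this
    rw [this]
    push_cast
    ring
  rw [← Finset.sum_erase (a := 0) _ (by simp [x])] at hx
  rw [← Finset.sum_erase (a := 0) _ (by simp [y])] at hy
  rw [eisensteinDiv_image, Finsupp.sum, ← Finset.sum_erase (a := 0) _ (by rw [hzero, mul_zero]),
    Finset.sum_congr rfl hterm, Finset.sum_sub_distrib, Finset.sum_sub_distrib, ← Finset.mul_sum,
    ← Finset.mul_sum, ← Complex.ofReal_sum, ← Complex.ofReal_sum, hx, hy]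
  simp

end EisensteinDivisor

end

open EisensteinDivisor in
theorem corollary2p6 (τ : ℍ) (ℓ : ℕ) (hℓ : 1 ≤ ℓ) :
    -- the analytic continuations that define the Eisenstein series exist
    (∀ a b : ℤ, IsEisensteinContinuation 1 τ (((a : ℂ) * τ + b) / ℓ)
      (eisenstein 1 τ (((a : ℂ) * τ + b) / ℓ))) ∧
    -- the constants `η₁`, `η₂` are the half quasi-periods of `ζ`
    (∀ z : ℂ, z ∉ lattice τ → ∀ m n : ℤ,
      zeta τ (z + m * τ + n) = zeta τ z + 2 * m * eta₂ τ + 2 * n * eta₁ τ) ∧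
    -- the formula for divisors
    (∀ (D : Curve τ →₀ ℤ) (Dt : ℂ →₀ ℤ), IsPrincipal τ D →
      (∀ P ∈ D.support, ℓ • P = 0) → IsPrincipalLift τ Dt D →
      (∀ α ∈ Dt.support, point τ α = 0 → α = 0) →
      eisensteinDiv 1 τ D 0 = ∑ α ∈ Dt.support.erase 0, (Dt α : ℂ) * zeta τ α) ∧
    -- the formula for points
    (∀ (a b : ℤ) (α : ℂ), α = ((a : ℂ) * τ + b) / ℓ → point τ α ≠ 0 →
      eisensteinPoint 1 τ (point τ α) 0 =
          zeta τ α + 1 / (ℓ : ℂ) * (zeta τ α - zeta τ (α + a * τ + b)) ∧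
      eisensteinPoint 1 τ (point τ α) 0 =
          zeta τ (((a : ℂ) * τ + b) / ℓ) - (a : ℂ) / ℓ * (2 * eta₂ τ)
            - (b : ℂ) / ℓ * (2 * eta₁ τ)) := by
  refine ⟨fun a b => isEisensteinContinuation_eisenstein τ _,
    fun z hz m n => zeta_add_int_mul_add_int hz m n, ?_, ?_⟩
  · rintro D Dt - - hlift hDt
    rw [← hlift.image_eq]
    exact eisensteinDiv_image_eq_sum_zeta Dt hlift.sum_point hDt
  · intro a b α hα hP
    have hn : α ∉ lattice τ := fun h => hP ((Submodule.Quotient.mk_eq_zero _).mpr h)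
    have hαxy : α = ((a / ℓ : ℝ) : ℂ) * τ + ((b / ℓ : ℝ) : ℂ) := by
      rw [hα]
      push_cast
      ring
    have h := eisenstein_one_apply_zero (a / ℓ) (b / ℓ) (hαxy ▸ hn)
    rw [← hαxy] at h
    push_cast at h
    rw [eisensteinPoint_point, ← hα, zeta_add_int_mul_add_int hn, h]
    constructor <;> ring
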